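/- For $n\ge 1$ let $\mathcal S_n(123)$ be the set of permutations $\sigma$ of $\{1,\ldots,n\}$ that avoid the pattern $123$, i.e. for which there are no indices $i_1<i_2<i_3$ with $\sigma(i_1)<\sigma(i_2)<\sigma(i_3)$, and let $\sigma\in\mathcal S_n(123)$ be chosen uniformly at random. Let $\mathrm{fp}_n(\sigma)=\#\{i : 1\le i\le n,\ \sigma(i)=i\}$ be the number of fixed points of $\sigma$. Then $$\mathbf E[\mathrm{fp}_n(\sigma)]\to \tfrac12 \quad\text{as } n\to\infty.$$ Moreover, for $\varepsilon>0$ and $a\in\mathbb R$ let $I_{n,\varepsilon}(a)$ be the set of those elements of $\{1,\ldots,n\}$ that lie in the interval $[(a-\varepsilon)n,(a+\varepsilon)n]$. Then for every $\varepsilon>0$ and every $a\in(0,\tfrac12-\varepsilon)\cup(\tfrac12+\varepsilon,1)$, $$\mathbf P\bigl(\sigma(i)=i \text{ for some } i\in I_{n,\varepsilon}(a)\bigr)\to 0\quad\text{as } n\to\infty.$$ -/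

import Mathlib

open Filter Topology

/-- `σ ∈ S_n` contains the pattern `τ ∈ S_m` if there are positions `i₁ < ⋯ < i_m` such that
`(σ(i₁), …, σ(i_m))` is in the same relative order as `(τ(1), …, τ(m))`. -/
def PermContains {m n : ℕ} (τ : Equiv.Perm (Fin m)) (σ : Equiv.Perm (Fin n)) : Prop :=
  ∃ f : Fin m → Fin n, StrictMono f ∧ ∀ a b : Fin m, σ (f a) < σ (f b) ↔ τ a < τ b

/-- The pattern `123`. -/
def pattern123 : Equiv.Perm (Fin 3) := Equiv.refl (Fin 3)

open Classical in
/-- `𝒮_n(τ)`: the permutations of `n` elements that avoid the pattern `τ`. -/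
noncomputable def avoiders {m : ℕ} (τ : Equiv.Perm (Fin m)) (n : ℕ) :
    Finset (Equiv.Perm (Fin n)) :=
  Finset.univ.filter (fun σ => ¬ PermContains τ σ)

/-- The number of fixed points of a permutation. -/
def fp {n : ℕ} (σ : Equiv.Perm (Fin n)) : ℕ :=
  (Finset.univ.filter (fun i : Fin n => σ i = i)).card

/-- The expectation of `X` at a uniformly random element of the finite set `S`. -/
noncomputable def uniformExpectation {Ω : Type*} (S : Finset Ω) (X : Ω → ℝ) : ℝ :=
  (∑ ω ∈ S, X ω) / (S.card : ℝ)

open Classical in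
/-- The probability that a uniformly random element of the finite set `S` satisfies `A`. -/
noncomputable def uniformProbability {Ω : Type*} (S : Finset Ω) (A : Ω → Prop) : ℝ :=
  ((S.filter A).card : ℝ) / (S.card : ℝ)

/-- `I_{n,ε}(a)`: the elements of `{1, …, n}` in the real interval `[(a - ε) n, (a + ε) n]`.
The index `i : Fin n`, which runs over `0, …, n - 1`, stands for the element `i + 1`. -/
def window (n : ℕ) (ε a : ℝ) : Set (Fin n) :=
  {i : Fin n | ((i : ℕ) : ℝ) + 1 ∈ Set.Icc ((a - ε) * (n : ℝ)) ((a + ε) * (n : ℝ))}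

/-! A 123-avoiding permutation is determined by its sequence of prefix minima, and these sequences
are exactly the partitions below a staircase (`prefixMin_injOn`, `exists_avoider_prefixMin_eq`).
Hence there are `catalan (n + 1)` avoiders in size `n + 1`.

A fixed point with a smaller value before it and a larger one after it would be the middle of a 123,
so every fixed point of an avoider is a left-to-right minimum or a right-to-left maximum. In size `n
+ 1`, a fixed left-to-right minimum at `i` is a corner of the partition at the diagonal cell `(i,
i)`. Deleting the row and column of that cell leaves a partition below the staircase of size `n`
that crosses the diagonal at `i`. Each such partition crosses exactly once, so the pairs (avoider,
fixed minimum) number `catalan n` (`sum_ncard_diagonalCorner`). Reverse complement gives the same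
total for maxima. A point of both kinds must be the exact middle, and such pairs are negligible
(`doublyExtremalFixedCount_le`). The expectation therefore tends to twice the limit `1/4` of
`catalan n / catalan (n + 1)`.

For the location, a diagonal corner splits the partition into two pieces in boxes, so at most `2 *
n.choose i ^ 2` avoiders fix `i` (`ncard_diagonalCorner_le_choose_sq`). Away from the middle a
Chernoff bound makes this exponentially smaller than `4 ^ n`, while `catalan n` is `4 ^ n` up to a
polynomial factor. -/

/-! ### Counting partitions in a box and below a staircase -/

/-- The sequence `c, m 0, m 1, …`. -/
def prepend (c : ℕ) (m : ℕ → ℕ) : ℕ → ℕ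
  | 0 => c
  | k + 1 => m k

lemma prepend_injective (c : ℕ) : Function.Injective (prepend c) := by
  intro m m' h
  funext k
  exact congrFun h (k + 1)

lemma antitone_prepend {c : ℕ} {m : ℕ → ℕ} (hm : Antitone m) (h : m 0 ≤ c) :
    Antitone (prepend c m) := by
  refine antitone_nat_of_succ_le fun k => ?_
  cases k with
  | zero => exact h
  | succ k => exact hm (Nat.le_succ k)

lemma prepend_tail (m : ℕ → ℕ) : prepend (m 0) (fun k => m (k + 1)) = m := by
  funext k
  cases k <;> rfl

lemma antitone_tail {m : ℕ → ℕ} (hm : Antitone m) : Antitone fun k => m (k + 1) :=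
  fun _ _ h => hm (Nat.succ_le_succ h)

/-- Partitions that fit into a box: at most `a` parts, each at most `b`. -/
def boxPartitions (a b : ℕ) : Set (ℕ → ℕ) :=
  {m | Antitone m ∧ (∀ k, m k ≤ b) ∧ ∀ k, a ≤ k → m k = 0}

lemma boxPartitions_zero_left (b : ℕ) : boxPartitions 0 b = {0} := by
  ext m
  simp only [boxPartitions, Set.mem_ofPred_eq, Set.mem_singleton_iff]
  constructor
  · rintro ⟨-, -, h⟩
    funext k
    exact h k (Nat.zero_le k)
  · rintro rfl
    exact ⟨antitone_const, by simp, by simp⟩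

lemma boxPartitions_zero_right (a : ℕ) : boxPartitions a 0 = {0} := by
  ext m
  simp only [boxPartitions, Set.mem_ofPred_eq, Set.mem_singleton_iff]
  constructor
  · rintro ⟨-, h, -⟩
    funext k
    exact Nat.le_zero.1 (h k)
  · rintro rfl
    exact ⟨antitone_const, by simp, by simp⟩

/-- Pascal's rule: either the largest part is below its bound, or it attains it and is removed. -/
lemma boxPartitions_succ_succ (a b : ℕ) :
    boxPartitions (a + 1) (b + 1) =
      boxPartitions (a + 1) b ∪ prepend (b + 1) '' boxPartitions a (b + 1) := by
  ext m
  constructor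
  · rintro ⟨h1, h2, h3⟩
    rcases Nat.lt_or_ge (m 0) (b + 1) with h | h
    · exact Or.inl ⟨h1, fun k => (h1 (Nat.zero_le k)).trans (by omega), h3⟩
    · refine Or.inr ⟨fun k => m (k + 1), ⟨antitone_tail h1, fun k => h2 _, fun k hk =>
        h3 _ (by omega)⟩, ?_⟩
      rw [← le_antisymm (h2 0) h, prepend_tail]
  · rintro (⟨h1, h2, h3⟩ | ⟨m, ⟨h1, h2, h3⟩, rfl⟩)
    · exact ⟨h1, fun k => (h2 k).trans (by omega), h3⟩
    · refine ⟨antitone_prepend h1 (h2 0), fun k => ?_, fun k hk => ?_⟩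
      · cases k with
        | zero => exact le_rfl
        | succ k => exact h2 k
      · cases k with
        | zero => omega
        | succ k => exact h3 k (by omega)

lemma boxPartitions_finite_and_ncard (a b : ℕ) :
    (boxPartitions a b).Finite ∧ (boxPartitions a b).ncard = (a + b).choose a := by
  induction a generalizing b with
  | zero => simp [boxPartitions_zero_left]
  | succ a iha =>
    induction b with
    | zero => simp [boxPartitions_zero_right]
    | succ b ihb =>
      rw [boxPartitions_succ_succ]
      refine ⟨ihb.1.union ((iha _).1.image _), ?_⟩
      rw [Set.ncard_union_eq _ ihb.1 ((iha _).1.image _),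
        Set.ncard_image_of_injective _ (prepend_injective _), ihb.2, (iha _).2,
        show a + 1 + (b + 1) = (a + b + 1) + 1 by ring, Nat.choose_succ_succ,
        show a + 1 + b = a + b + 1 by ring, show a + (b + 1) = a + b + 1 by ring, add_comm]
      rw [Set.disjoint_left]
      rintro _ ⟨-, h, -⟩ ⟨m, -, rfl⟩
      exact absurd (h 0) (by simp [prepend])

lemma finite_boxPartitions (a b : ℕ) : (boxPartitions a b).Finite :=
  (boxPartitions_finite_and_ncard a b).1

lemma ncard_boxPartitions (a b : ℕ) : (boxPartitions a b).ncard = (a + b).choose a :=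
  (boxPartitions_finite_and_ncard a b).2

/-- Partitions with parts at most `i` that fit below the staircase `l - 1, l - 2, …, 0`. -/
def ballotPartitions (l i : ℕ) : Set (ℕ → ℕ) :=
  {m | Antitone m ∧ (∀ k, m k ≤ i) ∧ ∀ k, m k ≤ l - 1 - k}

lemma finite_ballotPartitions (l i : ℕ) : (ballotPartitions l i).Finite := by
  refine (finite_boxPartitions l i).subset ?_
  rintro m ⟨h1, h2, h3⟩
  exact ⟨h1, h2, fun k hk => by have := h3 k; omega⟩

lemma ballotPartitions_zero_right (l : ℕ) : ballotPartitions l 0 = {0} := by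
  ext m
  simp only [ballotPartitions, Set.mem_ofPred_eq, Set.mem_singleton_iff]
  constructor
  · rintro ⟨-, h, -⟩
    funext k
    exact Nat.le_zero.1 (h k)
  · rintro rfl
    exact ⟨antitone_const, by simp, by simp⟩

lemma ballotPartitions_succ_self (l : ℕ) :
    ballotPartitions (l + 1) (l + 1) = ballotPartitions (l + 1) l := by
  ext m
  constructor
  · rintro ⟨h1, h2, h3⟩
    exact ⟨h1, fun k => (h3 k).trans (by omega), h3⟩
  · rintro ⟨h1, h2, h3⟩
    exact ⟨h1, fun k => (h2 k).trans (by omega), h3⟩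

lemma ballotPartitions_succ_succ {l i : ℕ} (hi : i + 1 ≤ l) :
    ballotPartitions (l + 1) (i + 1) =
      ballotPartitions (l + 1) i ∪ prepend (i + 1) '' ballotPartitions l (i + 1) := by
  ext m
  constructor
  · rintro ⟨h1, h2, h3⟩
    rcases Nat.lt_or_ge (m 0) (i + 1) with h | h
    · exact Or.inl ⟨h1, fun k => (h1 (Nat.zero_le k)).trans (by omega), h3⟩
    · refine Or.inr ⟨fun k => m (k + 1), ⟨antitone_tail h1, fun k => h2 _, fun k =>
        (h3 (k + 1)).trans (by omega)⟩, ?_⟩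
      rw [← le_antisymm (h2 0) h, prepend_tail]
  · rintro (⟨h1, h2, h3⟩ | ⟨m, ⟨h1, h2, h3⟩, rfl⟩)
    · exact ⟨h1, fun k => (h2 k).trans (by omega), h3⟩
    · refine ⟨antitone_prepend h1 (h2 0), fun k => ?_, fun k => ?_⟩
      · cases k with
        | zero => exact le_rfl
        | succ k => exact h2 k
      · cases k with
        | zero => simpa [prepend] using hi
        | succ k => exact (h3 k).trans (by omega)

lemma ncard_ballotPartitions_succ_succ {l i : ℕ} (hi : i + 1 ≤ l) :
    (ballotPartitions (l + 1) (i + 1)).ncard =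
      (ballotPartitions (l + 1) i).ncard + (ballotPartitions l (i + 1)).ncard := by
  rw [ballotPartitions_succ_succ hi, Set.ncard_union_eq _ (finite_ballotPartitions _ _)
    ((finite_ballotPartitions _ _).image _),
    Set.ncard_image_of_injective _ (prepend_injective _)]
  rw [Set.disjoint_left]
  rintro _ ⟨-, h, -⟩ ⟨m, -, rfl⟩
  exact absurd (h 0) (by simp [prepend])

/-- These are the ballot numbers. The extra bound `i` on the parts is what makes a two-term
recursion available; the staircase count is the case `i = l`. -/
lemma succ_mul_ncard_ballotPartitions (l i : ℕ) (hi : i ≤ l) :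
    ((l : ℤ) + 1) * (ballotPartitions l i).ncard = ((l : ℤ) + 1 - i) * (l + i).choose i := by
  induction l generalizing i with
  | zero =>
    obtain rfl : i = 0 := by omega
    simp [ballotPartitions_zero_right]
  | succ l ihl =>
    induction i with
    | zero => simp [ballotPartitions_zero_right]
    | succ i ihi =>
      have h1 := ihi (by omega)
      rcases Nat.lt_or_ge l (i + 1) with h | h
      -- On the boundary the recursion is replaced by the redundancy of the bound `l + 1`: the
      -- staircase already keeps the parts at most `l`.
      · obtain rfl : i = l := by omega
        rw [ballotPartitions_succ_self]
        have h2 : (i + 1 + (i + 1)).choose (i + 1) = 2 * (i + 1 + i).choose i := by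
          rw [show i + 1 + (i + 1) = (i + 1 + i) + 1 by ring, Nat.choose_succ_succ,
            Nat.choose_symm_of_eq_add (show i + 1 + i = (i + 1) + i by ring)]
          ring
        rw [h2]
        push_cast at h1 ⊢
        linear_combination h1
      · have h2 := ihl (i + 1) h
        rw [ncard_ballotPartitions_succ_succ h]
        have h3 : (l + 1 + (i + 1)).choose (i + 1) =
            (l + 1 + i).choose i + (l + 1 + i).choose (i + 1) := by
          rw [show l + 1 + (i + 1) = (l + 1 + i) + 1 by ring, Nat.choose_succ_succ]
        have h4 := Nat.choose_succ_right_eq (l + 1 + i) i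
        rw [show l + 1 + i - i = l + 1 by omega] at h4
        rw [show l + (i + 1) = l + 1 + i by ring] at h2
        rw [h3]
        have h5 : ((l + 1 + i).choose (i + 1) : ℤ) * (i + 1) = (l + 1 + i).choose i * (l + 1) := by
          exact_mod_cast h4
        have h6 : (l : ℤ) + 1 ≠ 0 := by positivity
        apply mul_left_cancel₀ h6
        push_cast at h1 h2 h5 ⊢
        linear_combination ((l : ℤ) + 1) * h1 + ((l : ℤ) + 2) * h2 - h5

/-- Partitions that fit below the staircase `n - 1, n - 2, …, 0`. -/
def staircasePartitions (n : ℕ) : Set (ℕ → ℕ) :=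
  {m | Antitone m ∧ ∀ k, m k ≤ n - 1 - k}

lemma staircasePartitions_eq_ballotPartitions (n : ℕ) :
    staircasePartitions n = ballotPartitions n n := by
  ext m
  constructor
  · rintro ⟨h1, h2⟩
    exact ⟨h1, fun k => (h2 k).trans (by omega), h2⟩
  · rintro ⟨h1, -, h2⟩
    exact ⟨h1, h2⟩

lemma finite_staircasePartitions (n : ℕ) : (staircasePartitions n).Finite := by
  rw [staircasePartitions_eq_ballotPartitions]
  exact finite_ballotPartitions n n

lemma ncard_staircasePartitions (n : ℕ) : (staircasePartitions n).ncard = catalan n := by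
  have h := succ_mul_ncard_ballotPartitions n n le_rfl
  rw [← staircasePartitions_eq_ballotPartitions, ← two_mul, ← Nat.centralBinom_eq_two_mul_choose,
    ← succ_mul_catalan_eq_centralBinom] at h
  have h' : (n : ℤ) + 1 ≠ 0 := by positivity
  have : ((staircasePartitions n).ncard : ℤ) = catalan n := by
    apply mul_left_cancel₀ h'
    push_cast at h ⊢
    linear_combination h
  exact_mod_cast this

/-! ### Corners on the diagonal -/

/-- The staircase partitions with a corner in the cell `(i, i)`. -/
def diagonalCorner (n i : ℕ) : Set (ℕ → ℕ) :=
  {m | m ∈ staircasePartitions n ∧ m i = i ∧ ∀ k < i, i < m k}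

/-- The staircase partitions whose boundary crosses the diagonal after `i` parts. -/
def diagonalCrossing (n i : ℕ) : Set (ℕ → ℕ) :=
  {m | m ∈ staircasePartitions n ∧ m i ≤ i ∧ ∀ k < i, i ≤ m k}

/-- Insertion of the cell `(i, i)` as a corner. -/
def insertCorner (i : ℕ) (m : ℕ → ℕ) (k : ℕ) : ℕ :=
  if k < i then m k + 1 else if k = i then i else m (k - 1)

lemma insertCorner_injective (i : ℕ) : Function.Injective (insertCorner i) := by
  intro m m' h
  funext k
  rcases Nat.lt_or_ge k i with hk | hk
  · have := congrFun h k
    simpa [insertCorner, hk] using this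
  · have := congrFun h (k + 1)
    simpa [insertCorner, show ¬ k + 1 < i by omega, show k + 1 ≠ i by omega] using this

/-- The inverse deletes row `i` and shortens each earlier row by one cell. Row and column together
account for the staircase growing by one. -/
lemma insertCorner_image (n i : ℕ) :
    insertCorner i '' diagonalCrossing n i = diagonalCorner (n + 1) i := by
  ext m
  constructor
  · rintro ⟨m, ⟨⟨h1, h2⟩, h3, h4⟩, rfl⟩
    refine ⟨⟨antitone_nat_of_succ_le fun k => ?_, fun k => ?_⟩, ?_, fun k hk => ?_⟩
    · have a1 := h1 (Nat.le_succ k)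
      have a2 := h1 (Nat.sub_le k 1)
      unfold insertCorner
      rcases lt_trichotomy (k + 1) i with h | h | h
      · simp [h, show k < i by omega, a1]
      · have := h4 k (by omega)
        simp [h, show k < i by omega]
        omega
      · rcases eq_or_ne k i with rfl | h'
        · simpa using h3
        · simp [show ¬ k + 1 < i by omega, show k + 1 ≠ i by omega, show ¬ k < i by omega, h', a2]
    · have a1 := h2 k
      have a2 := h2 (k - 1)
      unfold insertCorner
      split_ifs with h h'
      · have := h4 k h
        omega
      · subst h'
        rcases Nat.eq_zero_or_pos k with rfl | hk
        · omega
        · have := h4 (k - 1) (by omega)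
          omega
      · omega
    · simp [insertCorner]
    · have := h4 k hk
      simp [insertCorner, hk]
      omega
  · rintro ⟨⟨h1, h2⟩, h3, h4⟩
    refine ⟨fun k => if k < i then m k - 1 else m (k + 1),
      ⟨⟨antitone_nat_of_succ_le fun k => ?_, fun k => ?_⟩, ?_, fun k hk => ?_⟩, ?_⟩
    · have a1 := h1 (Nat.le_succ k)
      have a2 := h1 (Nat.le_succ (k + 1))
      simp only [Nat.succ_eq_add_one] at a1 a2
      split_ifs with h h' h'
      · omega
      · omega
      · obtain rfl : i = k + 1 := by omega
        have := h4 k (by omega)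
        omega
      · exact a2
    · have a1 := h2 k
      have a2 := h2 (k + 1)
      dsimp only
      split_ifs <;> omega
    · have := h1 (Nat.le_succ i)
      simpa [h3] using this
    · have := h4 k hk
      simp [hk]
      omega
    · funext k
      unfold insertCorner
      rcases lt_trichotomy k i with h | h | h
      · have := h4 k h
        simp [h]
        omega
      · simp [h, h3]
      · simp [show ¬ k < i by omega, show k ≠ i by omega, show ¬ k - 1 < i by omega,
          show k - 1 + 1 = k by omega]

lemma sum_ncard_diagonalCorner (n : ℕ) :
    ∑ i ∈ Finset.range (n + 1), (diagonalCorner (n + 1) i).ncard = catalan n := by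
  classical
  have hfin : ∀ i, (diagonalCrossing n i).Finite := fun i =>
    (finite_staircasePartitions n).subset fun m hm => hm.1
  -- The crossing index is the side of the Durfee square, the first `i` with `m i ≤ i`.
  have hunion : staircasePartitions n =
      ((Finset.range (n + 1)).biUnion fun i => (hfin i).toFinset : Finset (ℕ → ℕ)) := by
    ext m
    simp only [Finset.coe_biUnion, Set.Finite.coe_toFinset, Set.mem_iUnion, Finset.mem_coe,
      Finset.mem_range, exists_prop]
    constructor
    · intro hm
      have hex : ∃ i, m i ≤ i := ⟨n, (hm.2 n).trans (by omega)⟩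
      refine ⟨Nat.find hex, ?_, hm, Nat.find_spec hex, fun k hk => ?_⟩
      · exact Nat.lt_succ_of_le (Nat.find_min' hex ((hm.2 n).trans (by omega)))
      · have h1 := Nat.find_min hex (m := Nat.find hex - 1) (by omega)
        have h2 := hm.1 (show k ≤ Nat.find hex - 1 by omega)
        omega
    · rintro ⟨i, -, hm⟩
      exact hm.1
  rw [← ncard_staircasePartitions, hunion, Set.ncard_coe_finset, Finset.card_biUnion]
  · refine Finset.sum_congr rfl fun i _ => ?_
    rw [← insertCorner_image, Set.ncard_image_of_injective _ (insertCorner_injective i),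
      Set.ncard_eq_toFinset_card _ (hfin i)]
  · have key : ∀ i j : ℕ, i < j → ∀ m, m ∈ diagonalCrossing n i → m ∉ diagonalCrossing n j := by
      rintro i j hij m ⟨-, h1, -⟩ ⟨-, -, h2⟩
      have := h2 i hij
      omega
    intro i _ j _ hij
    change Disjoint (hfin i).toFinset (hfin j).toFinset
    rw [Finset.disjoint_left]
    intro m hm hm'
    rw [Set.Finite.mem_toFinset] at hm hm'
    rcases lt_or_gt_of_ne hij with h | h
    · exact key i j h m hm hm'
    · exact key j i h m hm' hm

/-- The parts above and below a corner in the cell `(i, i)`. -/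
def splitCorner (i : ℕ) (m : ℕ → ℕ) : (ℕ → ℕ) × (ℕ → ℕ) :=
  (fun k => m k - (i + 1), fun k => m (i + 1 + k))

lemma splitCorner_injOn (n i : ℕ) : Set.InjOn (splitCorner i) (diagonalCorner n i) := by
  rintro m ⟨-, h1, h2⟩ m' ⟨-, h1', h2'⟩ h
  funext k
  rcases lt_trichotomy k i with hk | hk | hk
  · have a := congrFun (congrArg Prod.fst h) k
    have b := h2 k hk
    have c := h2' k hk
    simp only [splitCorner] at a
    omega
  · rw [hk, h1, h1']
  · have a := congrFun (congrArg Prod.snd h) (k - (i + 1))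
    simpa [splitCorner, show i + 1 + (k - (i + 1)) = k by omega] using a

lemma ncard_diagonalCorner_le_of_mapsTo {n i : ℕ} {s t : Set (ℕ → ℕ)} (hs : s.Finite)
    (ht : t.Finite) (h : Set.MapsTo (splitCorner i) (diagonalCorner n i) (s ×ˢ t)) :
    (diagonalCorner n i).ncard ≤ s.ncard * t.ncard := by
  rw [← Set.ncard_prod]
  exact Set.ncard_le_ncard_of_injOn _ h (splitCorner_injOn n i) (hs.prod ht)

/-- The piece right of the corner has at most `i` rows, and the piece below it has parts at most
`i`; the staircase bounds the other dimension by `n - i`. The staircase shape itself is discarded.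
-/
lemma ncard_diagonalCorner_le_choose_sq {n i : ℕ} (hi : i ≤ n) :
    (diagonalCorner (n + 1) i).ncard ≤ n.choose i ^ 2 := by
  refine (ncard_diagonalCorner_le_of_mapsTo (finite_boxPartitions i (n - i))
    (finite_boxPartitions (n - i) i) ?_).trans_eq ?_
  · rintro m ⟨⟨h1, h2⟩, h3, h4⟩
    refine ⟨⟨fun a b hab => Nat.sub_le_sub_right (h1 hab) _, fun k => ?_, fun k hk => ?_⟩,
      ⟨fun a b hab => h1 (by omega), fun k => ?_, fun k hk => ?_⟩⟩
    · have := h2 k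
      simp only [splitCorner]
      omega
    · have := h1 hk
      simp only [splitCorner]
      omega
    · have := h1 (show i ≤ i + 1 + k by omega)
      simp only [splitCorner]
      omega
    · have := h2 (i + 1 + k)
      simp only [splitCorner]
      omega
  · rw [ncard_boxPartitions, ncard_boxPartitions, Nat.add_sub_cancel' hi, Nat.sub_add_cancel hi,
      Nat.choose_symm hi, sq]

/-- At the exact middle both pieces lie below a staircase of size `i`. This saves the polynomial
factor over the box bound that makes the middle negligible. -/
lemma ncard_diagonalCorner_middle_le (i : ℕ) :
    (diagonalCorner (2 * i + 1) i).ncard ≤ catalan i ^ 2 := by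
  rw [sq, ← ncard_staircasePartitions]
  refine ncard_diagonalCorner_le_of_mapsTo (finite_staircasePartitions i)
    (finite_staircasePartitions i) ?_
  rintro m ⟨⟨h1, h2⟩, h3, h4⟩
  refine ⟨⟨fun a b hab => Nat.sub_le_sub_right (h1 hab) _, fun k => ?_⟩,
    ⟨fun a b hab => h1 (by omega), fun k => ?_⟩⟩
  · have := h2 k
    -- For `k ≥ i` these give `m k ≤ m i = i`, so the truncated difference is zero.
    have a := h1 (le_max_left k i)
    have b := h1 (le_max_right k i)
    simp only [splitCorner]
    omega
  · have := h2 (i + 1 + k)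
    simp only [splitCorner]
    omega

/-! ### Prefix minima: avoiders correspond to staircase partitions -/

lemma permContains_pattern123_iff {n : ℕ} (σ : Equiv.Perm (Fin n)) :
    PermContains pattern123 σ ↔ ∃ a b c : Fin n, a < b ∧ b < c ∧ σ a < σ b ∧ σ b < σ c := by
  constructor
  · rintro ⟨f, hf, h⟩
    exact ⟨f 0, f 1, f 2, hf (by decide), hf (by decide), (h 0 1).2 (by decide),
      (h 1 2).2 (by decide)⟩
  · rintro ⟨a, b, c, hab, hbc, h1, h2⟩
    have hf : StrictMono ![a, b, c] := by
      rw [Fin.strictMono_iff_lt_succ]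
      intro i
      fin_cases i
      · exact hab
      · exact hbc
    have hg : StrictMono (σ ∘ ![a, b, c]) := by
      rw [Fin.strictMono_iff_lt_succ]
      intro i
      fin_cases i
      · exact h1
      · exact h2
    exact ⟨![a, b, c], hf, fun x y => hg.lt_iff_lt⟩

lemma mem_avoiders_pattern123 {n : ℕ} {σ : Equiv.Perm (Fin n)} :
    σ ∈ avoiders pattern123 n ↔ ∀ a b c : Fin n, a < b → b < c → σ a < σ b → σ c ≤ σ b := by
  simp only [avoiders, Finset.mem_filter, Finset.mem_univ, true_and, permContains_pattern123_iff]
  push Not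
  rfl

/-- The smallest of the values `σ 0, …, σ k`. -/
noncomputable def prefixMin {n : ℕ} (σ : Equiv.Perm (Fin n)) (k : ℕ) : ℕ :=
  sInf {v | ∃ j : Fin n, (j : ℕ) ≤ k ∧ (σ j : ℕ) = v}

lemma prefixMin_le {n : ℕ} (σ : Equiv.Perm (Fin n)) {k : ℕ} {j : Fin n} (h : (j : ℕ) ≤ k) :
    prefixMin σ k ≤ σ j :=
  Nat.sInf_le ⟨j, h, rfl⟩

lemma exists_eq_prefixMin {n : ℕ} (σ : Equiv.Perm (Fin (n + 1))) (k : ℕ) :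
    ∃ j : Fin (n + 1), (j : ℕ) ≤ k ∧ (σ j : ℕ) = prefixMin σ k :=
  Nat.sInf_mem (s := {v | ∃ j : Fin (n + 1), (j : ℕ) ≤ k ∧ (σ j : ℕ) = v})
    ⟨_, 0, Nat.zero_le k, rfl⟩

lemma prefixMin_mem_staircasePartitions {n : ℕ} (σ : Equiv.Perm (Fin (n + 1))) :
    prefixMin σ ∈ staircasePartitions (n + 1) := by
  have hanti : Antitone (prefixMin σ) := by
    intro a b hab
    obtain ⟨j, hj, h⟩ := exists_eq_prefixMin σ a
    rw [← h]
    exact prefixMin_le σ (hj.trans hab)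
  have key : ∀ k ≤ n, prefixMin σ k ≤ n - k := by
    intro k hk
    -- The first `k + 1` values are distinct and lie between the prefix minimum and `n`.
    have hcard : (Finset.univ : Finset (Fin (k + 1))).card ≤
        (Finset.Icc (prefixMin σ k) n).card := by
      refine Finset.card_le_card_of_injOn
        (fun j : Fin (k + 1) => (σ (Fin.castLE (by omega) j) : ℕ)) (fun j _ => ?_) ?_
      · simp only [Finset.coe_Icc, Set.mem_Icc]
        exact ⟨prefixMin_le σ (by simpa using Nat.lt_succ_iff.1 j.2),
          Nat.lt_succ_iff.1 (Fin.is_lt _)⟩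
      · intro a _ b _ h
        exact Fin.castLE_injective _ (σ.injective (Fin.ext h))
    simp only [Finset.card_univ, Fintype.card_fin, Nat.card_Icc] at hcard
    omega
  refine ⟨hanti, fun k => ?_⟩
  rcases Nat.le_total k n with h | h
  · simpa using key k h
  · have h1 := key n le_rfl
    have h2 := hanti h
    omega

/-- Look at the first disagreement `k`, say `σ k < τ k`. If the minimum of `σ` was attained earlier,
at `j`, then `σ` takes the value `τ k` after `k`, which completes a 123 with `j` and `k`. If it is
attained at `k`, equality of the prefix minima forces `τ k = σ k`. -/
lemma prefixMin_injOn (n : ℕ) :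
    Set.InjOn prefixMin (avoiders pattern123 (n + 1) : Set (Equiv.Perm (Fin (n + 1)))) := by
  have key : ∀ σ ∈ avoiders pattern123 (n + 1), ∀ τ ∈ avoiders pattern123 (n + 1),
      prefixMin σ = prefixMin τ → ∀ k : Fin (n + 1), (∀ j < k, σ j = τ j) → ¬ σ k < τ k := by
    intro σ hσ τ hτ h k ih hlt
    rw [mem_avoiders_pattern123] at hσ
    obtain ⟨j, hj, hj'⟩ := exists_eq_prefixMin σ k
    rcases (Fin.le_def.2 hj).lt_or_eq with hjk | rfl
    · have h1 : σ j < σ k := by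
        refine lt_of_le_of_ne ?_ (fun e => hjk.ne (σ.injective e))
        rw [Fin.le_def, hj']
        exact prefixMin_le σ le_rfl
      have h2 : σ (σ.symm (τ k)) = τ k := σ.apply_symm_apply _
      have h3 : k < σ.symm (τ k) := by
        by_contra hcon
        rcases (not_lt.1 hcon).lt_or_eq with hl | hl
        · have := ih _ hl
          rw [h2] at this
          exact hl.ne (τ.injective this).symm
        · rw [hl] at h2
          exact hlt.ne h2
      have h4 := hσ j k _ hjk h3 h1
      rw [h2] at h4
      exact absurd hlt (not_lt.2 h4)
    · obtain ⟨i, hi, hi'⟩ := exists_eq_prefixMin τ j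
      rw [← h, ← hj'] at hi'
      rcases (Fin.le_def.2 hi).lt_or_eq with hij | rfl
      · rw [← ih i hij] at hi'
        exact hij.ne (σ.injective (Fin.ext hi'))
      · exact hlt.ne (Fin.ext hi'.symm)
  intro σ hσ τ hτ h
  ext1 k
  induction k using WellFoundedLT.induction with
  | ind k ih =>
    refine le_antisymm ?_ ?_
    · exact not_lt.1 (key τ hτ σ hσ h.symm k fun j hj => (ih j hj).symm)
    · exact not_lt.1 (key σ hσ τ hτ h k ih)

open Classical in
/-- The `123`-avoiding sequence with values below `n` and prefix minima `m`: a new minimum is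
placed where `m` decreases, and the largest value not used so far elsewhere. -/
noncomputable def greedyFilling (n : ℕ) (m : ℕ → ℕ) (k : ℕ) : ℕ :=
  if ∀ j < k, m k < m j then m k
  else sSup {v | v < n ∧ ∀ j : Fin k, greedyFilling n m j ≠ v}
termination_by k
decreasing_by exact j.2

lemma greedyFilling_of_forall_lt {n : ℕ} {m : ℕ → ℕ} {k : ℕ} (h : ∀ j < k, m k < m j) :
    greedyFilling n m k = m k := by
  rw [greedyFilling, if_pos h]

lemma bddAbove_unused (n k : ℕ) (g : ℕ → ℕ) :
    BddAbove {v | v < n ∧ ∀ j : Fin k, g j ≠ v} :=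
  ⟨n, fun _ hv => hv.1.le⟩

lemma le_greedyFilling {n : ℕ} {m : ℕ → ℕ} {k v : ℕ} (h : ¬ ∀ j < k, m k < m j) (hv : v < n)
    (hv' : ∀ j < k, greedyFilling n m j ≠ v) : v ≤ greedyFilling n m k := by
  rw [greedyFilling, if_neg h]
  exact le_csSup (bddAbove_unused n k _) ⟨hv, fun j => hv' j j.2⟩

lemma greedyFilling_spec {n : ℕ} {m : ℕ → ℕ} (hm : m ∈ staircasePartitions n) (k : ℕ)
    (hk : k < n) : greedyFilling n m k < n ∧ m k ≤ greedyFilling n m k ∧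
      (∀ j < k, greedyFilling n m j ≠ greedyFilling n m k) ∧
      ∃ j ≤ k, greedyFilling n m j = m k := by
  induction k using Nat.strong_induction_on with
  | _ k ih =>
    have hmk := hm.2 k
    by_cases h : ∀ j < k, m k < m j
    · rw [greedyFilling_of_forall_lt h]
      refine ⟨by omega, le_rfl, fun j hj => ?_, k, le_rfl, greedyFilling_of_forall_lt h⟩
      have h1 := (ih j hj (by omega)).2.1
      have h2 := h j hj
      omega
    -- Pigeonhole: the staircase condition leaves at least `k + 1` values from `m k` up, and only
    -- `k` values have been used.
    · obtain ⟨v, hv, hv'⟩ : ∃ v ∈ Finset.Ico (m k) n,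
          v ∉ (Finset.range k).image (greedyFilling n m) := by
        apply Finset.exists_mem_notMem_of_card_lt_card
        refine (Finset.card_image_le).trans_lt ?_
        rw [Finset.card_range, Nat.card_Ico]
        omega
      rw [Finset.mem_Ico] at hv
      have hv'' : ∀ j < k, greedyFilling n m j ≠ v := fun j hj e =>
        hv' (Finset.mem_image.2 ⟨j, Finset.mem_range.2 hj, e⟩)
      have hmem : greedyFilling n m k ∈
          {v | v < n ∧ ∀ j : Fin k, greedyFilling n m j ≠ v} := by
        rw [greedyFilling.eq_1 n m k, if_neg h]
        exact Nat.sSup_mem ⟨v, hv.2, fun j => hv'' j j.2⟩ (bddAbove_unused n k _)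
      refine ⟨hmem.1, hv.1.trans (le_greedyFilling h hv.2 hv''), fun j hj => hmem.2 ⟨j, hj⟩, ?_⟩
      push Not at h
      obtain ⟨j, hj, hjm⟩ := h
      obtain ⟨i, hi, hi'⟩ := (ih j hj (by omega)).2.2.2
      exact ⟨i, by omega, hi'.trans (le_antisymm hjm (hm.1 hj.le))⟩

lemma exists_avoider_prefixMin_eq {n : ℕ} {m : ℕ → ℕ} (hm : m ∈ staircasePartitions (n + 1)) :
    ∃ σ ∈ avoiders pattern123 (n + 1), prefixMin σ = m := by
  set g := greedyFilling (n + 1) m with hg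
  have hspec := fun k : Fin (n + 1) => greedyFilling_spec hm k k.2
  let f : Fin (n + 1) → Fin (n + 1) := fun k => ⟨g k, (hspec k).1⟩
  have hf : Function.Injective f := by
    intro a b hab
    have hab' : g a = g b := congrArg Fin.val hab
    rcases lt_trichotomy a b with h | h | h
    · exact absurd hab' ((hspec b).2.2.1 a h)
    · exact h
    · exact absurd hab'.symm ((hspec a).2.2.1 b h)
  let σ : Equiv.Perm (Fin (n + 1)) := Equiv.ofBijective f (Finite.injective_iff_bijective.1 hf)
  have hσ : ∀ k, (σ k : ℕ) = g k := fun k => rfl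
  have hpre : ∀ k ≤ n, prefixMin σ k = m k := by
    intro k hk
    refine le_antisymm ?_ ?_
    · obtain ⟨j, hj, h⟩ := (hspec ⟨k, by omega⟩).2.2.2
      rw [← h]
      have hj' : j ≤ k := hj
      exact prefixMin_le σ (j := ⟨j, by omega⟩) hj
    · obtain ⟨j, hj, h⟩ := exists_eq_prefixMin σ k
      rw [← h, hσ]
      exact (hm.1 hj).trans (hspec j).2.1
  refine ⟨σ, ?_, ?_⟩
  · rw [mem_avoiders_pattern123]
    intro a b c hab hbc h
    rw [Fin.lt_def, hσ, hσ] at h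
    rw [Fin.le_def, hσ, hσ]
    -- Since `σ a < σ b`, position `b` carries no new minimum, so it received the largest unused
    -- value; the value at `c` was still unused then.
    refine le_greedyFilling (fun hlt => ?_) (hspec c).1 fun j hj => ?_
    · rw [hg, greedyFilling_of_forall_lt hlt] at h
      have h1 := hlt a hab
      have h2 := (hspec a).2.1
      omega
    · exact (hspec c).2.2.1 j (hj.trans hbc)
  · funext k
    rcases Nat.le_total k n with h | h
    · exact hpre k h
    · have h1 := (prefixMin_mem_staircasePartitions σ).2 k
      have h2 := hm.2 k
      omega

lemma prefixMin_image_avoiders (n : ℕ) :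
    prefixMin '' (avoiders pattern123 (n + 1) : Set (Equiv.Perm (Fin (n + 1)))) =
      staircasePartitions (n + 1) := by
  ext m
  constructor
  · rintro ⟨σ, -, rfl⟩
    exact prefixMin_mem_staircasePartitions σ
  · intro hm
    obtain ⟨σ, hσ, h⟩ := exists_avoider_prefixMin_eq hm
    exact ⟨σ, hσ, h⟩

lemma card_avoiders_pattern123 (n : ℕ) : (avoiders pattern123 (n + 1)).card = catalan (n + 1) := by
  rw [← ncard_staircasePartitions, ← prefixMin_image_avoiders,
    (prefixMin_injOn n).ncard_image, Set.ncard_coe_finset]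

/-! ### Fixed points as diagonal corners -/

/-- The fixed point `i` of `σ` is a left-to-right minimum. -/
def IsMinFixed {n : ℕ} (σ : Equiv.Perm (Fin n)) (i : Fin n) : Prop :=
  σ i = i ∧ ∀ k < i, i < σ k

/-- The fixed point `i` of `σ` is a right-to-left maximum. -/
def IsMaxFixed {n : ℕ} (σ : Equiv.Perm (Fin n)) (i : Fin n) : Prop :=
  σ i = i ∧ ∀ k, i < k → σ k < i

lemma isMinFixed_iff {n : ℕ} (σ : Equiv.Perm (Fin (n + 1))) (i : Fin (n + 1)) :
    IsMinFixed σ i ↔ prefixMin σ ∈ diagonalCorner (n + 1) i := by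
  constructor
  · rintro ⟨h1, h2⟩
    refine ⟨prefixMin_mem_staircasePartitions σ, ?_, fun k hk => ?_⟩
    · obtain ⟨j, hj, h⟩ := exists_eq_prefixMin σ i
      rcases (Fin.le_def.2 hj).lt_or_eq with hji | rfl
      · have h3 := Fin.lt_def.1 (h2 j hji)
        have h4 := prefixMin_le σ (le_refl (i : ℕ))
        rw [h1] at h4
        omega
      · rw [← h, h1]
    · obtain ⟨j, hj, h⟩ := exists_eq_prefixMin σ k
      rw [← h]
      exact h2 j (Fin.lt_def.2 (by omega))
  · rintro ⟨-, h1, h2⟩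
    refine ⟨?_, fun k hk => Fin.lt_def.2 ((h2 k hk).trans_le (prefixMin_le σ le_rfl))⟩
    obtain ⟨j, hj, h⟩ := exists_eq_prefixMin σ i
    rcases (Fin.le_def.2 hj).lt_or_eq with hji | rfl
    · have h3 := h2 j hji
      have h4 := prefixMin_le σ (le_refl (j : ℕ))
      omega
    · exact Fin.ext (h.trans h1)

open Classical in
lemma card_isMinFixed (n : ℕ) (i : Fin (n + 1)) :
    ((avoiders pattern123 (n + 1)).filter fun σ => IsMinFixed σ i).card =
      (diagonalCorner (n + 1) i).ncard := by
  rw [← Set.ncard_coe_finset, ← Set.InjOn.ncard_image (f := prefixMin)]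
  · congr 1
    ext m
    simp only [Finset.coe_filter, Set.mem_image, Set.mem_ofPred_eq, isMinFixed_iff]
    constructor
    · rintro ⟨σ, ⟨-, h⟩, rfl⟩
      exact h
    · intro h
      obtain ⟨σ, hσ, rfl⟩ := exists_avoider_prefixMin_eq h.1
      exact ⟨σ, ⟨hσ, h⟩, rfl⟩
  · exact (prefixMin_injOn n).mono fun σ hσ => (Finset.mem_filter.1 hσ).1

/-- The reverse complement of a permutation. -/
def reverseComplement {n : ℕ} (σ : Equiv.Perm (Fin n)) : Equiv.Perm (Fin n) :=
  Fin.revPerm.trans (σ.trans Fin.revPerm)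

lemma reverseComplement_apply {n : ℕ} (σ : Equiv.Perm (Fin n)) (i : Fin n) :
    reverseComplement σ i = (σ i.rev).rev := rfl

lemma reverseComplement_involutive (n : ℕ) :
    Function.Involutive (reverseComplement : Equiv.Perm (Fin n) → Equiv.Perm (Fin n)) := by
  intro σ
  ext1 i
  simp [reverseComplement_apply]

lemma reverseComplement_mem_avoiders {n : ℕ} {σ : Equiv.Perm (Fin n)}
    (h : σ ∈ avoiders pattern123 n) : reverseComplement σ ∈ avoiders pattern123 n := by
  rw [mem_avoiders_pattern123] at h ⊢
  intro a b c hab hbc h1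
  simp only [reverseComplement_apply, Fin.rev_lt_rev, Fin.rev_le_rev] at h1 ⊢
  by_contra hcon
  exact absurd h1 (not_lt.2 (h _ _ _ (Fin.rev_lt_rev.2 hbc) (Fin.rev_lt_rev.2 hab)
    (not_le.1 hcon)))

lemma isMinFixed_reverseComplement_iff {n : ℕ} (σ : Equiv.Perm (Fin n)) (i : Fin n) :
    IsMinFixed (reverseComplement σ) i.rev ↔ IsMaxFixed σ i := by
  simp only [IsMinFixed, IsMaxFixed, reverseComplement_apply, Fin.rev_rev, Fin.rev_inj,
    Fin.rev_lt_rev]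
  refine and_congr_right fun _ => ⟨fun h k hk => ?_, fun h k hk => h _ (Fin.lt_rev_iff.1 hk)⟩
  simpa using h k.rev (Fin.rev_lt_rev.2 hk)

-- Reverse complement preserves 123-avoidance and exchanges the two kinds of fixed point, sending
-- `i` to `i.rev`.
open Classical in
lemma card_isMaxFixed (n : ℕ) (i : Fin (n + 1)) :
    ((avoiders pattern123 (n + 1)).filter fun σ => IsMaxFixed σ i).card =
      (diagonalCorner (n + 1) i.rev).ncard := by
  rw [← card_isMinFixed]
  refine Finset.card_nbij' reverseComplement reverseComplement ?_ ?_
    (fun σ _ => reverseComplement_involutive _ σ) (fun σ _ => reverseComplement_involutive _ σ)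
  · intro σ hσ
    simp only [Finset.coe_filter, Set.mem_ofPred_eq, isMinFixed_reverseComplement_iff] at hσ ⊢
    exact ⟨reverseComplement_mem_avoiders hσ.1, hσ.2⟩
  · intro σ hσ
    simp only [Finset.coe_filter, Set.mem_ofPred_eq] at hσ ⊢
    refine ⟨reverseComplement_mem_avoiders hσ.1, ?_⟩
    rw [← isMinFixed_reverseComplement_iff, reverseComplement_involutive]
    exact hσ.2

lemma fixed_iff_of_mem_avoiders {n : ℕ} {σ : Equiv.Perm (Fin n)}
    (hσ : σ ∈ avoiders pattern123 n) (i : Fin n) :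
    σ i = i ↔ IsMinFixed σ i ∨ IsMaxFixed σ i := by
  refine ⟨fun h => ?_, fun h => h.elim And.left And.left⟩
  by_contra hcon
  simp only [IsMinFixed, IsMaxFixed, h, true_and, not_or] at hcon
  push Not at hcon
  obtain ⟨⟨a, hai, ha⟩, ⟨c, hic, hc⟩⟩ := hcon
  rw [mem_avoiders_pattern123] at hσ
  have ha' : σ a < σ i := by
    rw [h]
    exact lt_of_le_of_ne ha fun e => hai.ne (σ.injective (e.trans h.symm))
  have h1 := hσ a i c hai hic ha'
  rw [h] at h1
  exact hic.ne' (σ.injective ((le_antisymm h1 hc).trans h.symm))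

/-- `σ` injects the positions before `i` into the values above `i`, and the positions after `i` into
the values below. -/
lemma eq_two_mul_of_isMinFixed_of_isMaxFixed {n : ℕ} {σ : Equiv.Perm (Fin (n + 1))}
    {i : Fin (n + 1)} (h1 : IsMinFixed σ i) (h2 : IsMaxFixed σ i) : n = 2 * i := by
  have a1 : (Finset.Iio i).card ≤ (Finset.Ioi i).card :=
    Finset.card_le_card_of_injOn σ (fun k hk => by simpa using h1.2 k (by simpa using hk))
      σ.injective.injOn
  have a2 : (Finset.Ioi i).card ≤ (Finset.Iio i).card :=
    Finset.card_le_card_of_injOn σ (fun k hk => by simpa using h2.2 k (by simpa using hk))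
      σ.injective.injOn
  rw [Fin.card_Iio, Fin.card_Ioi] at a1 a2
  omega

/-- The number of pairs of a `123`-avoiding permutation of `n` elements and a fixed point that is
both a left-to-right minimum and a right-to-left maximum. -/
noncomputable def doublyExtremalFixedCount (n : ℕ) : ℕ := by
  classical
  exact ∑ i : Fin n,
    ((avoiders pattern123 n).filter fun σ => IsMinFixed σ i ∧ IsMaxFixed σ i).card

/-- Inclusion–exclusion over the two kinds of fixed point, each contributing `catalan n` in total.
-/
lemma sum_fp_add_doublyExtremalFixedCount (n : ℕ) :
    ∑ σ ∈ avoiders pattern123 (n + 1), fp σ + doublyExtremalFixedCount (n + 1) =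
      2 * catalan n := by
  classical
  have h1 : ∑ σ ∈ avoiders pattern123 (n + 1), fp σ =
      ∑ i : Fin (n + 1), ((avoiders pattern123 (n + 1)).filter fun σ => σ i = i).card := by
    simp only [fp, Finset.card_filter]
    exact Finset.sum_comm
  have h2 : ∀ i : Fin (n + 1),
      ((avoiders pattern123 (n + 1)).filter fun σ => σ i = i).card +
        ((avoiders pattern123 (n + 1)).filter fun σ => IsMinFixed σ i ∧ IsMaxFixed σ i).card =
      (diagonalCorner (n + 1) i).ncard + (diagonalCorner (n + 1) i.rev).ncard := by
    intro i
    rw [Finset.filter_congr fun σ hσ => fixed_iff_of_mem_avoiders hσ i, Finset.filter_or,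
      Finset.filter_and, Finset.card_union_add_card_inter, ← card_isMinFixed, ← card_isMaxFixed]
  have h3 : ∑ i : Fin (n + 1), (diagonalCorner (n + 1) i).ncard = catalan n := by
    rw [← sum_ncard_diagonalCorner, Finset.sum_range]
  have h4 : ∑ i : Fin (n + 1), (diagonalCorner (n + 1) i.rev).ncard = catalan n := by
    rw [← h3]
    exact Equiv.sum_comp Fin.revPerm fun i : Fin (n + 1) => (diagonalCorner (n + 1) i).ncard
  rw [h1, doublyExtremalFixedCount, ← Finset.sum_add_distrib, Finset.sum_congr rfl fun i _ => h2 i,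
    Finset.sum_add_distrib, h3, h4, two_mul]

/-! ### Catalan estimates and the expectation -/

lemma succ_mul_catalan_le_four_pow (n : ℕ) : (n + 1) * catalan n ≤ 4 ^ n := by
  rw [succ_mul_catalan_eq_centralBinom, Nat.centralBinom_eq_two_mul_choose]
  calc (2 * n).choose n ≤ 2 ^ (2 * n) := Nat.choose_le_two_pow _ _
    _ = 4 ^ n := by rw [pow_mul]; norm_num

lemma doublyExtremalFixedCount_le (n : ℕ) :
    (n + 2) ^ 2 * doublyExtremalFixedCount (n + 1) ≤ 4 * 4 ^ n := by
  classical
  have hle : ∀ i : Fin (n + 1),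
      ((avoiders pattern123 (n + 1)).filter fun σ => IsMinFixed σ i ∧ IsMaxFixed σ i).card ≤
        if n = 2 * (i : ℕ) then catalan i ^ 2 else 0 := by
    intro i
    split_ifs with h
    · calc _ ≤ ((avoiders pattern123 (n + 1)).filter fun σ => IsMinFixed σ i).card :=
            Finset.card_le_card (Finset.monotone_filter_right _ fun σ _ hσ => hσ.1)
        _ = (diagonalCorner (n + 1) i).ncard := card_isMinFixed n i
        _ = (diagonalCorner (2 * (i : ℕ) + 1) i).ncard := by rw [← h]
        _ ≤ catalan i ^ 2 := ncard_diagonalCorner_middle_le i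
    · refine (Finset.card_eq_zero.2 (Finset.filter_eq_empty_iff.2 fun σ _ hσ => h ?_)).le
      exact eq_two_mul_of_isMinFixed_of_isMaxFixed hσ.1 hσ.2
  have hsum : doublyExtremalFixedCount (n + 1) ≤
      ∑ i ∈ Finset.range (n + 1), if n = 2 * i then catalan i ^ 2 else 0 := by
    rw [Finset.sum_range]
    exact Finset.sum_le_sum fun i _ => hle i
  rcases Nat.even_or_odd' n with ⟨j, rfl | rfl⟩
  · have h1 : ∑ i ∈ Finset.range (2 * j + 1), (if 2 * j = 2 * i then catalan i ^ 2 else 0) =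
        catalan j ^ 2 := by
      rw [Finset.sum_eq_single j]
      · simp
      · intro i _ hi
        rw [if_neg (by omega)]
      · intro h
        exact absurd (Finset.mem_range.2 (by omega)) h
    rw [h1] at hsum
    calc (2 * j + 2) ^ 2 * doublyExtremalFixedCount (2 * j + 1)
        ≤ (2 * j + 2) ^ 2 * catalan j ^ 2 := Nat.mul_le_mul_left _ hsum
      _ = 4 * ((j + 1) * catalan j) ^ 2 := by ring
      _ ≤ 4 * (4 ^ j) ^ 2 :=
        Nat.mul_le_mul_left _ (Nat.pow_le_pow_left (succ_mul_catalan_le_four_pow j) 2)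
      _ = 4 * 4 ^ (2 * j) := by ring
  · have h1 : ∑ i ∈ Finset.range (2 * j + 1 + 1),
        (if 2 * j + 1 = 2 * i then catalan i ^ 2 else 0) = 0 :=
      Finset.sum_eq_zero fun i _ => if_neg (by omega)
    rw [h1, Nat.le_zero] at hsum
    simp [hsum]

/-- With `m = n + 1`, the ratio of the right side to the left is nondecreasing, because `2m(2m + 2)
≤ (2m + 1)²`; equality holds at `m = 1`. -/
lemma sixteen_pow_le_centralBinom_sq (n : ℕ) :
    16 ^ (n + 1) ≤ 4 * (n + 1) * (n + 1).centralBinom ^ 2 := by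
  induction n with
  | zero => norm_num [Nat.centralBinom]
  | succ n ih =>
    have h := Nat.succ_mul_centralBinom_succ (n + 1)
    have h' : ((n + 1 + 1) * (n + 1 + 1).centralBinom) ^ 2 =
        (2 * (2 * (n + 1) + 1) * (n + 1).centralBinom) ^ 2 := congrArg (· ^ 2) h
    refine Nat.le_of_mul_le_mul_left ?_ (show 0 < n + 1 + 1 by omega)
    calc (n + 1 + 1) * 16 ^ (n + 1 + 1) = 16 * (n + 2) * 16 ^ (n + 1) := by ring
      _ ≤ 16 * (n + 2) * (4 * (n + 1) * (n + 1).centralBinom ^ 2) := Nat.mul_le_mul_left _ ih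
      _ = 4 * (4 * (2 * (n + 1)) * (2 * (n + 2))) * (n + 1).centralBinom ^ 2 := by ring
      _ ≤ 4 * ((2 * (2 * (n + 1) + 1)) ^ 2) * (n + 1).centralBinom ^ 2 := by
        refine Nat.mul_le_mul_right _ (Nat.mul_le_mul_left _ ?_)
        ring_nf
        omega
      _ = 4 * (2 * (2 * (n + 1) + 1) * (n + 1).centralBinom) ^ 2 := by ring
      _ = (n + 1 + 1) * (4 * (n + 1 + 1) * (n + 1 + 1).centralBinom ^ 2) := by
        rw [← h']
        ring

lemma four_pow_le_sqrt_mul_catalan (n : ℕ) :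
    (4 : ℝ) ^ (n + 1) ≤ 2 * √(n + 1) * ((n + 2) * catalan (n + 1)) := by
  have h := sixteen_pow_le_centralBinom_sq n
  rw [← succ_mul_catalan_eq_centralBinom] at h
  have h' : (16 : ℝ) ^ (n + 1) ≤ 4 * (n + 1) * ((n + 1 + 1) * catalan (n + 1)) ^ 2 := by
    exact_mod_cast h
  refine (sq_le_sq₀ (by positivity) (by positivity)).1 ?_
  calc ((4 : ℝ) ^ (n + 1)) ^ 2 = 16 ^ (n + 1) := by rw [← pow_mul, mul_comm, pow_mul]; norm_num
    _ ≤ _ := h'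
    _ = (2 * √(n + 1) * ((n + 2) * catalan (n + 1))) ^ 2 := by
      rw [mul_pow (2 * √_), mul_pow 2, Real.sq_sqrt (by positivity)]
      ring

lemma catalan_pos (n : ℕ) : 0 < catalan n := by
  have h := Nat.centralBinom_pos n
  rw [← succ_mul_catalan_eq_centralBinom] at h
  exact Nat.pos_of_mul_pos_left h

lemma catalan_div_catalan_succ (n : ℕ) :
    (catalan n : ℝ) / catalan (n + 1) = (n + 2) / (2 * (2 * n + 1)) := by
  have h := Nat.succ_mul_centralBinom_succ n
  rw [← succ_mul_catalan_eq_centralBinom, ← succ_mul_catalan_eq_centralBinom] at h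
  have h' : ((n : ℝ) + 1) * ((n + 1 + 1) * catalan (n + 1)) =
      2 * (2 * n + 1) * ((n + 1) * catalan n) := by exact_mod_cast h
  have hc : (0 : ℝ) < catalan (n + 1) := by exact_mod_cast catalan_pos (n + 1)
  rw [div_eq_div_iff hc.ne' (by positivity)]
  have hn : (n : ℝ) + 1 ≠ 0 := by positivity
  apply mul_left_cancel₀ hn
  linear_combination -h'

lemma tendsto_catalan_div_catalan_succ :
    Tendsto (fun n : ℕ => (catalan n : ℝ) / catalan (n + 1)) atTop (𝓝 (1 / 4)) := by
  have h : ∀ n : ℕ, (catalan n : ℝ) / catalan (n + 1) = 1 / 4 + 3 / 8 * (1 / ((n : ℝ) + 1 / 2)) := by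
    intro n
    rw [catalan_div_catalan_succ]
    field_simp
    ring
  simp only [h]
  have : Tendsto (fun n : ℕ => 1 / ((n : ℝ) + 1 / 2)) atTop (𝓝 0) :=
    tendsto_const_nhds.div_atTop
      (tendsto_atTop_add_const_right _ _ tendsto_natCast_atTop_atTop)
  have h' := (this.const_mul (3 / 8)).const_add (1 / 4)
  rwa [mul_zero, add_zero] at h'

lemma doublyExtremalFixedCount_div_catalan_le (n : ℕ) :
    (doublyExtremalFixedCount (n + 1) : ℝ) / catalan (n + 1) ≤ 2 / √(n + 1) := by
  have h1 : ((n : ℝ) + 2) ^ 2 * doublyExtremalFixedCount (n + 1) ≤ 4 * 4 ^ n := by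
    exact_mod_cast doublyExtremalFixedCount_le n
  have h2 := four_pow_le_sqrt_mul_catalan n
  have hc : (0 : ℝ) < catalan (n + 1) := by exact_mod_cast catalan_pos (n + 1)
  have hs : 0 < √((n : ℝ) + 1) := Real.sqrt_pos.2 (by positivity)
  have hs2 : √((n : ℝ) + 1) ^ 2 = n + 1 := Real.sq_sqrt (by positivity)
  rw [div_le_div_iff₀ hc hs]
  have h3 : ((n : ℝ) + 2) ^ 2 * doublyExtremalFixedCount (n + 1) ≤
      2 * √(n + 1) * ((n + 2) * catalan (n + 1)) := by
    refine h1.trans (le_trans (le_of_eq ?_) h2)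
    ring
  have h4 : ((n : ℝ) + 2) ^ 2 * (doublyExtremalFixedCount (n + 1) * √(n + 1)) ≤
      ((n : ℝ) + 2) ^ 2 * (2 * catalan (n + 1)) := by
    calc ((n : ℝ) + 2) ^ 2 * (doublyExtremalFixedCount (n + 1) * √(n + 1))
        = ((n : ℝ) + 2) ^ 2 * doublyExtremalFixedCount (n + 1) * √(n + 1) := by ring
      _ ≤ 2 * √(n + 1) * ((n + 2) * catalan (n + 1)) * √(n + 1) :=
        mul_le_mul_of_nonneg_right h3 hs.le
      _ = 2 * √((n : ℝ) + 1) ^ 2 * ((n + 2) * catalan (n + 1)) := by ring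
      _ = ((n : ℝ) + 1) * ((n + 2) * (2 * catalan (n + 1))) := by rw [hs2]; ring
      _ ≤ ((n : ℝ) + 2) * ((n + 2) * (2 * catalan (n + 1))) :=
        mul_le_mul_of_nonneg_right (by linarith) (by positivity)
      _ = _ := by ring
  exact le_of_mul_le_mul_left h4 (by positivity)

lemma tendsto_uniformExpectation_fp :
    Tendsto (fun n : ℕ => uniformExpectation (avoiders pattern123 n) (fun σ => (fp σ : ℝ)))
      atTop (𝓝 (1 / 2 : ℝ)) := by
  rw [← tendsto_add_atTop_iff_nat 1]
  have h : ∀ n : ℕ, uniformExpectation (avoiders pattern123 (n + 1)) (fun σ => (fp σ : ℝ)) =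
      2 * ((catalan n : ℝ) / catalan (n + 1)) -
        (doublyExtremalFixedCount (n + 1) : ℝ) / catalan (n + 1) := by
    intro n
    have h1 : ∑ σ ∈ avoiders pattern123 (n + 1), (fp σ : ℝ) +
        doublyExtremalFixedCount (n + 1) = 2 * catalan n := by
      exact_mod_cast sum_fp_add_doublyExtremalFixedCount n
    rw [uniformExpectation, card_avoiders_pattern123, eq_sub_of_add_eq h1, sub_div, mul_div_assoc]
  simp only [h]
  have h0 : Tendsto (fun n : ℕ => (doublyExtremalFixedCount (n + 1) : ℝ) / catalan (n + 1))
      atTop (𝓝 0) := by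
    refine squeeze_zero (fun n => div_nonneg (Nat.cast_nonneg _) (Nat.cast_nonneg _))
      doublyExtremalFixedCount_div_catalan_le ?_
    exact tendsto_const_nhds.div_atTop (Real.tendsto_sqrt_atTop.comp
      (tendsto_atTop_add_const_right _ _ tendsto_natCast_atTop_atTop))
  have := (tendsto_catalan_div_catalan_succ.const_mul 2).sub h0
  norm_num at this ⊢
  exact this

/-! ### Chernoff bound and the location of fixed points -/

lemma one_add_exp_neg_le (s : ℝ) : 1 + Real.exp (-s) ≤ 2 * Real.exp (-s / 2 + s ^ 2 / 8) := by
  have h1 : 1 + Real.exp (-s) = 2 * (Real.exp (-s / 2) * Real.cosh (s / 2)) := by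
    rw [Real.cosh_eq, mul_div_assoc', mul_add, ← Real.exp_add, ← Real.exp_add,
      show -s / 2 + s / 2 = 0 by ring, show -s / 2 + -(s / 2) = -s by ring, Real.exp_zero]
    ring
  have h2 := Real.cosh_le_exp_half_sq (s / 2)
  rw [show (s / 2) ^ 2 / 2 = s ^ 2 / 8 by ring] at h2
  rw [h1, Real.exp_add]
  gcongr

lemma choose_le_of_le_mul {c : ℝ} (hc : c < 1 / 2) {n i : ℕ} (hi : (i : ℝ) ≤ c * (n + 1)) :
    (n.choose i : ℝ) ≤ (2 * Real.exp (-2 * (1 / 2 - c) ^ 2)) ^ (n + 1) := by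
  -- This tilt minimises the exponent `s * c - s / 2 + s ^ 2 / 8`, with minimum `-2 * (1 / 2 - c) ^
  -- 2`.
  set s := 4 * (1 / 2 - c) with hs
  have hs0 : 0 < s := by linarith
  rcases Nat.lt_or_ge n i with h | hin
  · rw [Nat.choose_eq_zero_of_lt h, Nat.cast_zero]
    positivity
  have h1 : Real.exp (-s) ^ i * n.choose i ≤ (1 + Real.exp (-s)) ^ n := by
    rw [add_comm (1 : ℝ), add_pow]
    have := Finset.single_le_sum (f := fun k => Real.exp (-s) ^ k * 1 ^ (n - k) * n.choose k)
      (fun k _ => by positivity) (Finset.mem_range.2 (Nat.lt_succ_of_le hin))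
    simpa using this
  have h2 : (1 + Real.exp (-s)) ^ n ≤ (2 * Real.exp (-s / 2 + s ^ 2 / 8)) ^ (n + 1) := by
    calc (1 + Real.exp (-s)) ^ n ≤ (1 + Real.exp (-s)) ^ (n + 1) :=
          pow_le_pow_right₀ (by linarith [Real.exp_pos (-s)]) (Nat.le_succ n)
      _ ≤ _ := pow_le_pow_left₀ (by positivity) (one_add_exp_neg_le s) _
  have h3 : Real.exp (s * i) ≤ Real.exp (s * c) ^ (n + 1) := by
    rw [← Real.exp_nat_mul, Real.exp_le_exp]
    push_cast
    nlinarith [mul_le_mul_of_nonneg_left hi hs0.le]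
  calc (n.choose i : ℝ) = Real.exp (s * i) * (Real.exp (-s) ^ i * n.choose i) := by
        rw [← Real.exp_nat_mul, ← mul_assoc, ← Real.exp_add,
          show s * i + i * -s = 0 by ring, Real.exp_zero, one_mul]
    _ ≤ Real.exp (s * c) ^ (n + 1) * (2 * Real.exp (-s / 2 + s ^ 2 / 8)) ^ (n + 1) :=
        mul_le_mul h3 (h1.trans h2) (by positivity) (by positivity)
    _ = (2 * Real.exp (-2 * (1 / 2 - c) ^ 2)) ^ (n + 1) := by
        rw [← mul_pow, mul_left_comm, ← Real.exp_add]
        congr 3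
        rw [hs]
        ring

lemma card_exists_fixed_le (n : ℕ) (W : Set (Fin (n + 1))) {B : ℝ}
    (hB : ∀ i ∈ W, (n.choose i : ℝ) ≤ B) :
    uniformProbability (avoiders pattern123 (n + 1)) (fun σ => ∃ i ∈ W, σ i = i) ≤
      (n + 1) * (2 * B ^ 2) / catalan (n + 1) := by
  classical
  rw [uniformProbability, card_avoiders_pattern123]
  refine div_le_div_of_nonneg_right ?_ (by positivity)
  set S := avoiders pattern123 (n + 1) with hS
  have h1 : S.filter (fun σ => ∃ i ∈ W, σ i = i) ⊆
      (Finset.univ.filter (· ∈ W)).biUnion fun i => S.filter fun σ => σ i = i := by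
    intro σ hσ
    rw [Finset.mem_filter] at hσ
    obtain ⟨hσS, i, hi, h⟩ := hσ
    exact Finset.mem_biUnion.2 ⟨i, by simpa using hi, Finset.mem_filter.2 ⟨hσS, h⟩⟩
  have h2 : ∀ i : Fin (n + 1), (S.filter fun σ => σ i = i).card ≤ 2 * n.choose i ^ 2 := by
    intro i
    rw [Finset.filter_congr fun σ hσ => fixed_iff_of_mem_avoiders hσ i, Finset.filter_or]
    refine (Finset.card_union_le _ _).trans ?_
    rw [card_isMinFixed, card_isMaxFixed, two_mul]
    refine add_le_add (ncard_diagonalCorner_le_choose_sq (Nat.lt_succ_iff.1 i.2)) ?_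
    refine (ncard_diagonalCorner_le_choose_sq (Nat.lt_succ_iff.1 i.rev.2)).trans_eq ?_
    rw [Fin.val_rev, Nat.add_sub_add_right, Nat.choose_symm (Nat.lt_succ_iff.1 i.2)]
  have key : ((S.filter fun σ => ∃ i ∈ W, σ i = i).card : ℝ) ≤ (n + 1) * (2 * B ^ 2) := by
    calc ((S.filter fun σ => ∃ i ∈ W, σ i = i).card : ℝ)
        ≤ ∑ i ∈ Finset.univ.filter (· ∈ W), ((S.filter fun σ => σ i = i).card : ℝ) := by
          exact_mod_cast (Finset.card_le_card h1).trans Finset.card_biUnion_le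
      _ ≤ ∑ i ∈ Finset.univ.filter (· ∈ W), 2 * B ^ 2 := by
          refine Finset.sum_le_sum fun i hi => ?_
          have h3 : ((S.filter fun σ => σ i = i).card : ℝ) ≤ 2 * (n.choose i : ℝ) ^ 2 := by
            exact_mod_cast h2 i
          have h4 := pow_le_pow_left₀ (Nat.cast_nonneg _) (hB i (Finset.mem_filter.1 hi).2) 2
          linarith
      _ ≤ ∑ _i : Fin (n + 1), 2 * B ^ 2 :=
          Finset.sum_le_sum_of_subset_of_nonneg (Finset.filter_subset _ _)
            fun _ _ _ => by positivity
      _ = (n + 1) * (2 * B ^ 2) := by simp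
  -- Only decidability instances differ here.
  refine le_trans (le_of_eq ?_) key
  congr!

lemma tendsto_uniformProbability_of_le_mul {c : ℝ} (hc : c < 1 / 2)
    (W : ∀ n : ℕ, Set (Fin n))
    (hW : ∀ n : ℕ, ∀ i ∈ W (n + 1), ((i : ℕ) : ℝ) ≤ c * (n + 1) ∨
      ((n - (i : ℕ) : ℕ) : ℝ) ≤ c * (n + 1)) :
    Tendsto (fun n : ℕ => uniformProbability (avoiders pattern123 n)
      (fun σ => ∃ i ∈ W n, σ i = i)) atTop (𝓝 0) := by
  rw [← tendsto_add_atTop_iff_nat 1]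
  set q := Real.exp (-2 * (1 / 2 - c) ^ 2) with hq
  have hq0 : 0 < q := Real.exp_pos _
  have hq1 : q < 1 := by
    rw [hq, Real.exp_lt_one_iff]
    have : 0 < (1 / 2 - c) ^ 2 := pow_pos (by linarith) 2
    linarith
  -- One factor `n + 1` comes from the union bound over `i`, two from the lower bound on the Catalan
  -- number; the powers of `4` cancel.
  refine squeeze_zero (g := fun n : ℕ => 8 * (((n + 1 : ℕ) : ℝ) ^ 3 * (q ^ 2) ^ (n + 1)))
    (fun n => ?_) (fun n => ?_) ?_
  · unfold uniformProbability
    positivity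
  · refine (card_exists_fixed_le n (W (n + 1)) (B := (2 * q) ^ (n + 1))
      fun i hi => ?_).trans ?_
    · rcases hW n i hi with h | h
      · exact choose_le_of_le_mul hc h
      · rw [← Nat.choose_symm (Nat.lt_succ_iff.1 i.2)]
        exact choose_le_of_le_mul hc h
    · have h1 := four_pow_le_sqrt_mul_catalan n
      have hcat : (0 : ℝ) < catalan (n + 1) := by exact_mod_cast catalan_pos (n + 1)
      have h2 : √((n : ℝ) + 1) ≤ n + 1 :=
        Real.sqrt_le_self_iff.2 (Or.inr (by linarith [Nat.cast_nonneg (α := ℝ) n]))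
      have h3 : (4 : ℝ) ^ (n + 1) ≤ 4 * (n + 1) ^ 2 * catalan (n + 1) := by
        calc (4 : ℝ) ^ (n + 1) ≤ 2 * √(n + 1) * ((n + 2) * catalan (n + 1)) := h1
          _ ≤ 2 * (n + 1) * ((2 * (n + 1)) * catalan (n + 1)) := by
            gcongr
            linarith [Nat.cast_nonneg (α := ℝ) n]
          _ = _ := by ring
      rw [div_le_iff₀ hcat]
      calc ((n : ℝ) + 1) * (2 * ((2 * q) ^ (n + 1)) ^ 2)
          = 2 * (n + 1) * (q ^ 2) ^ (n + 1) * 4 ^ (n + 1) := by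
            rw [← pow_mul, mul_comm (n + 1) 2, pow_mul, mul_pow 2 q, mul_pow]
            norm_num
            ring
        _ ≤ 2 * (n + 1) * (q ^ 2) ^ (n + 1) * (4 * (n + 1) ^ 2 * catalan (n + 1)) := by gcongr
        _ = 8 * (((n : ℝ) + 1) ^ 3 * (q ^ 2) ^ (n + 1)) * catalan (n + 1) := by ring
        _ = _ := by push_cast; ring
  · have h := tendsto_pow_const_mul_const_pow_of_lt_one 3 (sq_nonneg q)
      (pow_lt_one₀ hq0.le hq1 two_ne_zero)
    simpa using ((tendsto_add_atTop_iff_nat 1).2 h).const_mul 8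

theorem mainTheorem10 :
    Tendsto
        (fun n : ℕ => uniformExpectation (avoiders pattern123 n) (fun σ => (fp σ : ℝ)))
        atTop (𝓝 (1 / 2 : ℝ)) ∧
      ∀ ε : ℝ, 0 < ε →
        ∀ a ∈ Set.Ioo (0 : ℝ) (1 / 2 - ε) ∪ Set.Ioo (1 / 2 + ε) 1,
          Tendsto
            (fun n : ℕ => uniformProbability (avoiders pattern123 n)
              (fun σ => ∃ i ∈ window n ε a, σ i = i))
            atTop (𝓝 0) := by
  refine ⟨tendsto_uniformExpectation_fp, fun ε _ a ha => ?_⟩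
  rcases ha with ⟨-, ha⟩ | ⟨ha, -⟩
  · refine tendsto_uniformProbability_of_le_mul (c := a + ε) (by linarith)
      (fun n => window n ε a) fun n i hi => Or.inl ?_
    have h := hi.2
    push_cast at h
    linarith
  -- Right of the middle, the lower end of the window bounds the distance `n - i = (n + 1) - (i +
  -- 1)` to the last index.
  · refine tendsto_uniformProbability_of_le_mul (c := 1 - a + ε) (by linarith)
      (fun n => window n ε a) fun n i hi => Or.inr ?_
    have h := hi.1
    push_cast [Nat.cast_sub (Nat.lt_succ_iff.1 i.2)] at h ⊢
    linarith
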